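/- Let $n\ge 1$, and let $\mathcal{H}^{n-1}$ be the $(n-1)$-dimensional Hausdorff measure (so that it is the usual surface measure on the unit sphere $S^{n-1}\subset\mathbb{R}^n$). Let $\mathcal{K}_o^n$ be the set of compact convex sets in $\mathbb{R}^n$ containing the origin in their interiors, with the Hausdorff metric. For $K\in\mathcal{K}_o^n$, let $h_K(u)=\max_{x\in K}\langle u,x\rangle$ and $\rho_K(u)=\max\{\lambda>0:\lambda u\in K\}$ for $u\in S^{n-1}$. A vector $v\in S^{n-1}$ is an outer unit normal of $K$ at $x\in\partial K$ if $\langle v,x\rangle=h_K(v)$; $x$ is regular if there is only one such $v$, which is then denoted by $\nu_K(x)$. For $u\in S^{n-1}$ such that $\rho_K(u)u$ is regular (which holds for $\mathcal{H}^{n-1}$-almost every $u$), put $\alpha_K(u)=\nu_K(\rho_K(u)u)$. For $E\subset S^{n-1}$, let $\boldsymbol{\alpha}^*_K(E)$ be the set of all $x/|x|$ such that $x\in\partial K$ has an outer unit normal in $E$. The surface area measure of $K$ is $S(K,E)=\mathcal{H}^{n-1}(\{x\in\partial K: x\text{ regular},\ \nu_K(x)\in E\})$ for Borel sets $E\subset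 S^{n-1}$. Let $G:(0,\infty)\times S^{n-1}\to\mathbb{R}$ be continuous, with a partial derivative $G_t(t,u)=\partial G(t,u)/\partial t$ that exists and is continuous on $(0,\infty)\times S^{n-1}$, and let $\psi:(0,\infty)\to(0,\infty)$ be continuous. For $K\in\mathcal{K}_o^n$, the general dual Orlicz curvature measure is the (well-defined) finite signed Borel measure on $S^{n-1}$ given by $$\widetilde{C}_{G,\psi}(K,E)=\frac1n\int_{\boldsymbol{\alpha}^*_K(E)}\frac{\rho_K(u)\,G_t(\rho_K(u),u)}{\psi(h_K(\alpha_K(u)))}\,d\mathcal{H}^{n-1}(u)$$ for Borel sets $E\subset S^{n-1}$; here $\boldsymbol{\alpha}^*_K(E)$ is $\mathcal{H}^{n-1}$-measurable and the integrand is integrable on $S^{n-1}$. Let $K\in\mathcal{K}_o^n$. The following statements hold. (i) $\widetilde{C}_{G,\psi}(K,\cdot)$ is absolutely continuous with respect to $S(K,\cdot)$. (ii) If $K_i\in\mathcal{K}_o^n$, $i\in\mathbb{N}$, and $K_i\to K$ in the Hausdorff metric, then $\widetilde{C}_{G,\psi}(K_i,\cdot)\to\widetilde{C}_{G,\psi}(K,\cdot)$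 weakly, that is, $\int g\,d\widetilde{C}_{G,\psi}(K_i,\cdot)\to\int g\,d\widetilde{C}_{G,\psi}(K,\cdot)$ for every continuous $g:S^{n-1}\to\mathbb{R}$. (iii) If $G_t>0$ on $(0,\infty)\times S^{n-1}$ (or $G_t<0$ on $(0,\infty)\times S^{n-1}$), then $\mu=\widetilde{C}_{G,\psi}(K,\cdot)$ (or $\mu=-\widetilde{C}_{G,\psi}(K,\cdot)$, respectively) is a nonzero finite Borel measure not concentrated on any closed hemisphere, that is, $\int_{S^{n-1}}\max\{\langle u,v\rangle,0\}\,d\mu(u)>0$ for every $v\in S^{n-1}$. -/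

import Mathlib

open MeasureTheory Set Filter Topology
open scoped RealInnerProductSpace

namespace DualOrlicz

/-- Euclidean space `ℝⁿ`. -/
abbrev Euc (n : ℕ) : Type := EuclideanSpace ℝ (Fin n)

/-- The unit sphere `S^{n-1}` in `ℝⁿ`. -/
abbrev Sph (n : ℕ) : Type := Metric.sphere (0 : Euc n) 1

/-- Convex bodies in `ℝⁿ` containing the origin in their interiors, with the Hausdorff metric
(inherited from Mathlib's metric on `ConvexBody`). -/
abbrev BodyO (n : ℕ) : Type := {K : ConvexBody (Euc n) // (0 : Euc n) ∈ interior (K : Set (Euc n))}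

/-- The boundary `∂K`. -/
def bd {n : ℕ} (K : BodyO n) : Set (Euc n) := frontier (K.1 : Set (Euc n))

/-- The support function `h_K(u) = sup {⟨u, x⟩ : x ∈ K}`. -/
noncomputable def supp {n : ℕ} (K : BodyO n) (u : Euc n) : ℝ :=
  sSup ((fun x : Euc n => ⟪u, x⟫) '' (K.1 : Set (Euc n)))

/-- The radial function `ρ_K(x) = sup {l > 0 : l x ∈ K}` (used for `x ≠ 0`). -/
noncomputable def radial {n : ℕ} (K : BodyO n) (x : Euc n) : ℝ :=
  sSup {l : ℝ | 0 < l ∧ l • x ∈ (K.1 : Set (Euc n))}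

/-- The supporting hyperplane `H(K, u)`. -/
def hyperplane {n : ℕ} (K : BodyO n) (u : Sph n) : Set (Euc n) :=
  {x | ⟪(u : Euc n), x⟫ = supp K u}

/-- The set-valued Gauss map (for `A ⊆ ∂K`): all outer unit normals at points of `A`. -/
def normals {n : ℕ} (K : BodyO n) (A : Set (Euc n)) : Set (Sph n) :=
  {u | ∃ x ∈ A, x ∈ hyperplane K u}

/-- The set-valued reverse Gauss map: all boundary points with an outer unit normal in `A`. -/
def normalPoints {n : ℕ} (K : BodyO n) (A : Set (Sph n)) : Set (Euc n) :=
  {x | x ∈ bd K ∧ ∃ u ∈ A, x ∈ hyperplane K u}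

/-- The set-valued radial Gauss map: all outer unit normals at the points `ρ_K(u) u`, `u ∈ A`. -/
noncomputable def radialNormals {n : ℕ} (K : BodyO n) (A : Set (Sph n)) : Set (Sph n) :=
  normals K ((fun u : Sph n => radial K u • (u : Euc n)) '' A)

/-- The set-valued reverse radial Gauss map:
all directions `x / |x|` of boundary points `x` with an outer unit normal in `A`. -/
def reverseRadial {n : ℕ} (K : BodyO n) (A : Set (Sph n)) : Set (Sph n) :=
  {w | ∃ x ∈ normalPoints K A, (w : Euc n) = ‖x‖⁻¹ • x}

/-- The radial Gauss map `α_K`: the unique outer unit normal at `ρ_K(u) u`.  Where this normal is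
not unique (on a null set of `u`) the value is arbitrary. -/
noncomputable def radialGauss {n : ℕ} (K : BodyO n) (u : Sph n) : Sph n :=
  open Classical in if h : ∃ v, radialNormals K {u} = {v} then h.choose else u

/-- Singular boundary points: those with two or more outer unit normals. -/
def singularPoints {n : ℕ} (K : BodyO n) : Set (Euc n) :=
  {x | x ∈ bd K ∧ (normals K {x}).Nontrivial}

/-- Regular boundary points. -/
def reg {n : ℕ} (K : BodyO n) : Set (Euc n) := bd K \ singularPoints K

theorem supp_bddAbove {n : ℕ} (K : BodyO n) (u : Euc n) :
    BddAbove ((fun x : Euc n => ⟪u, x⟫) '' (K.1 : Set (Euc n))) :=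
  (K.1.isCompact.image (by fun_prop)).bddAbove

theorem mem_hyperplane_iff {n : ℕ} (K : BodyO n) (u : Sph n) {x : Euc n}
    (hx : x ∈ (K.1 : Set (Euc n))) :
    x ∈ hyperplane K u ↔ ∀ y ∈ (K.1 : Set (Euc n)), ⟪(u : Euc n), y⟫ ≤ ⟪(u : Euc n), x⟫ := by
  constructor
  · intro h y hy
    have h' : ⟪(u : Euc n), x⟫ = supp K u := h
    rw [h']
    exact le_csSup (supp_bddAbove K u) (mem_image_of_mem _ hy)
  · intro h
    refine le_antisymm (le_csSup (supp_bddAbove K u) (mem_image_of_mem _ hx)) ?_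
    refine csSup_le (K.1.nonempty.image _) ?_
    rintro _ ⟨y, hy, rfl⟩
    exact h y hy

theorem bd_subset {n : ℕ} (K : BodyO n) : bd K ⊆ (K.1 : Set (Euc n)) :=
  K.1.isClosed.frontier_subset

/-- Every boundary point has an outer unit normal. -/
theorem normals_nonempty {n : ℕ} (K : BodyO n) {x : Euc n} (hx : x ∈ bd K) :
    (normals K {x}).Nonempty := by
  have hxi : x ∉ interior (K.1 : Set (Euc n)) := hx.2
  obtain ⟨f, hf⟩ := geometric_hahn_banach_open_point K.1.convex.interior isOpen_interior hxi
  set w : Euc n := (InnerProductSpace.toDual ℝ (Euc n)).symm f with hw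
  have hfw : ∀ y, f y = ⟪w, y⟫ := fun y => by
    rw [hw, InnerProductSpace.toDual_symm_apply]
  have hw0 : w ≠ 0 := by
    intro h0
    have := hf 0 K.2
    simp [hfw, h0] at this
  have hwn : 0 < ‖w‖ := norm_pos_iff.mpr hw0
  have hle : ∀ y ∈ (K.1 : Set (Euc n)), ⟪w, y⟫ ≤ ⟪w, x⟫ := by
    intro y hy
    have hcl : y ∈ closure (interior (K.1 : Set (Euc n))) := by
      rw [K.1.convex.closure_interior_eq_closure_of_nonempty_interior ⟨0, K.2⟩]
      exact subset_closure hy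
    have hc : IsClosed {z : Euc n | ⟪w, z⟫ ≤ ⟪w, x⟫} :=
      isClosed_le (by fun_prop) continuous_const
    refine hc.closure_subset_iff.mpr ?_ hcl
    intro z hz
    have := (hf z hz).le
    simpa [hfw] using this
  refine ⟨⟨‖w‖⁻¹ • w, by simp [norm_smul, hwn.ne']⟩, x, rfl, ?_⟩
  rw [mem_hyperplane_iff K _ (bd_subset K hx)]
  intro y hy
  simp only [real_inner_smul_left]
  exact mul_le_mul_of_nonneg_left (hle y hy) (by positivity)

/-- A regular boundary point has exactly one outer unit normal. -/
theorem reg_existsUnique {n : ℕ} (K : BodyO n) (x : reg K) : ∃ v, normals K {(x : Euc n)} = {v} := by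
  obtain ⟨v, hv⟩ := normals_nonempty K x.2.1
  refine ⟨v, ?_⟩
  have hs : (normals K {(x : Euc n)}).Subsingleton := by
    rw [← not_nontrivial_iff]
    exact fun h => x.2.2 ⟨x.2.1, h⟩
  exact hs.eq_singleton_of_mem hv

/-- The Gauss map `ν_K` on regular boundary points: the unique outer unit normal. -/
noncomputable def gauss {n : ℕ} (K : BodyO n) (x : reg K) : Sph n := (reg_existsUnique K x).choose

theorem gauss_spec {n : ℕ} (K : BodyO n) (x : reg K) : normals K {(x : Euc n)} = {gauss K x} :=
  (reg_existsUnique K x).choose_spec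

theorem gauss_eq_iff {n : ℕ} (K : BodyO n) (x : reg K) (u : Sph n) :
    gauss K x = u ↔ ∀ y ∈ (K.1 : Set (Euc n)), ⟪(u : Euc n), y⟫ ≤ ⟪(u : Euc n), (x : Euc n)⟫ := by
  rw [← mem_hyperplane_iff K u (bd_subset K x.2.1)]
  have h : (x : Euc n) ∈ hyperplane K u ↔ u ∈ normals K {(x : Euc n)} := by simp [normals]
  rw [h, gauss_spec, mem_singleton_iff, eq_comm]

theorem continuous_gauss {n : ℕ} (K : BodyO n) : Continuous (gauss K) := by
  rw [continuous_iff_isClosed]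
  intro C hC
  have hcl : IsClosed {p : reg K × Sph n | p.2 ∈ C ∧
      ∀ y ∈ (K.1 : Set (Euc n)), ⟪(p.2 : Euc n), y⟫ ≤ ⟪(p.2 : Euc n), (p.1 : Euc n)⟫} := by
    refine (hC.preimage continuous_snd).inter ?_
    have heq : {p : reg K × Sph n | ∀ y ∈ (K.1 : Set (Euc n)),
        ⟪(p.2 : Euc n), y⟫ ≤ ⟪(p.2 : Euc n), (p.1 : Euc n)⟫} =
        ⋂ y ∈ (K.1 : Set (Euc n)), {p : reg K × Sph n |
          ⟪(p.2 : Euc n), y⟫ ≤ ⟪(p.2 : Euc n), (p.1 : Euc n)⟫} := by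
      ext p
      simp
    change IsClosed {p : reg K × Sph n | ∀ y ∈ (K.1 : Set (Euc n)),
        ⟪(p.2 : Euc n), y⟫ ≤ ⟪(p.2 : Euc n), (p.1 : Euc n)⟫}
    rw [heq]
    exact isClosed_biInter fun y _ => isClosed_le (by fun_prop) (by fun_prop)
  have himg := isClosedMap_fst_of_compactSpace _ hcl
  convert! himg using 1
  ext x
  simp only [mem_preimage, mem_image, mem_ofPred_eq, Prod.exists, exists_and_right, exists_eq_right]
  constructor
  · intro h
    exact ⟨gauss K x, h, (gauss_eq_iff K x _).1 rfl⟩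
  · rintro ⟨u, hu, h⟩
    rw [(gauss_eq_iff K x u).2 h]
    exact hu

/-- The surface area measure `S(K, ·)`: the image under the Gauss map of the
`(n-1)`-dimensional Hausdorff measure (with Euclidean normalization) on the regular points. -/
noncomputable def surfaceArea {n : ℕ} (K : BodyO n) : Measure (Sph n) :=
  (μHE[n - 1] : Measure (reg K)).map (gauss K)

/-- `S(K, A)` is the `(n-1)`-dimensional Hausdorff measure of the inverse Gauss image of `A`. -/
theorem surfaceArea_apply {n : ℕ} (K : BodyO n) {A : Set (Sph n)} (hA : MeasurableSet A) :
    surfaceArea K A = (μHE[n - 1] : Measure (Euc n)) {x | ∃ h : x ∈ reg K, gauss K ⟨x, h⟩ ∈ A} := by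
  rw [surfaceArea, Measure.map_apply (continuous_gauss K).measurable hA,
    ← (isometry_subtype_coe (s := reg K)).euclideanHausdorffMeasure_image]
  congr 1
  ext x
  simp

/-- The density `ρ_K(u) G_t(ρ_K(u), u) / ψ(h_K(α_K(u)))` on the sphere. -/
noncomputable def density {n : ℕ} (G : ℝ → Sph n → ℝ) (ψ : ℝ → ℝ) (K : BodyO n) (u : Sph n) : ℝ :=
  radial K u * deriv (fun t => G t u) (radial K u) / ψ (supp K (radialGauss K u))

/-- The set function
`A ↦ (1/n) ∫_{α*_K(A)} ρ_K(u) G_t(ρ_K(u), u) / ψ(h_K(α_K(u))) du`,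
where `du` is the `(n-1)`-dimensional Hausdorff measure on the sphere. -/
noncomputable def curvatureValue {n : ℕ} (G : ℝ → Sph n → ℝ) (ψ : ℝ → ℝ) (K : BodyO n)
    (A : Set (Sph n)) : ℝ :=
  (1 / (n : ℝ)) * ∫ u in reverseRadial K A, density G ψ K u ∂(μHE[n - 1] : Measure (Sph n))

/-- The general dual Orlicz curvature measure: the signed Borel measure on the sphere whose value
on every Borel set `A` is `curvatureValue G ψ K A` (and `0` if there is no such signed measure). -/
noncomputable def curvatureMeasure {n : ℕ} (G : ℝ → Sph n → ℝ) (ψ : ℝ → ℝ) (K : BodyO n) :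
    SignedMeasure (Sph n) :=
  open Classical in
  if h : ∃ C : SignedMeasure (Sph n), ∀ A, MeasurableSet A → C A = curvatureValue G ψ K A
  then h.choose else 0

/-- A measure `μ` on the sphere is not concentrated on any closed hemisphere:
`∫ ⟨u, v⟩₊ dμ(u) > 0` for every unit vector `v`. -/
def NotInClosedHemisphere {n : ℕ} (μ : Measure (Sph n)) : Prop :=
  ∀ v : Sph n, 0 < ∫ u : Sph n, max ⟪(u : Euc n), (v : Euc n)⟫ 0 ∂μ

/-- Weak convergence of a sequence of signed measures on the sphere. -/
def WeakConv {n : ℕ} (C : ℕ → SignedMeasure (Sph n)) (D : SignedMeasure (Sph n)) : Prop :=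
  ∀ g : Sph n → ℝ, Continuous g →
    Tendsto (fun i => ∫ᵛ u, g u ∂•(C i)) atTop (𝓝 (∫ᵛ u, g u ∂•D))

end DualOrlicz

open DualOrlicz

/-!
Since `h_K > 0`, the functionals `⟪v / h_K(v), ·⟫` are linear minorants of the gauge of `K`, and
`v` is normal to `K` at `ρ_K(u) u` exactly when the minorant of `v` touches the gauge at `u`. The
gauge is Lipschitz, so by Rademacher's theorem in gnomonic charts of the sphere it is almost
everywhere differentiable there. At such a point the touching minorant is determined by the value
and the derivative, hence the normal is unique for almost every `u`.

It follows that `α*_K(A)` and `α_K⁻¹(A)` agree up to a null set, so the curvature measure is the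
push-forward under `α_K` of `H^{n-1}` with density `(1/n) ρ_K G_t / ψ(h_K ∘ α_K)`. Absolute
continuity holds because `x ↦ x / |x|` is Lipschitz away from the origin and so preserves null
sets. As the normal cones have a closed graph in `(K, u)`, the map `(K, u) ↦ α_K(u)` is continuous
wherever the normal is unique, and weak convergence is dominated convergence. Finally
`⟪w, u⟫ > 0` for every normal `w` at `ρ_K(u) u`; by the closed graph again `⟪α_K(u), v⟫ > 0` for
`u` near `v`, a set of positive measure.
-/

namespace DualOrlicz

section HausdorffMeasure

theorem euclideanHausdorffMeasure_image_le {X Y : Type*} [MetricSpace X] [MeasurableSpace X]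
    [BorelSpace X] [MetricSpace Y] [MeasurableSpace Y] [BorelSpace Y] {f : X → Y} {C : NNReal}
    {s : Set X} (hf : LipschitzOnWith C f s) (d : ℕ) :
    (μHE[d] : Measure Y) (f '' s) ≤ (C : ENNReal) ^ d * (μHE[d] : Measure X) s := by
  simp only [Measure.euclideanHausdorffMeasure_def, Measure.smul_apply, ENNReal.smul_def,
    smul_eq_mul]
  rw [mul_left_comm]
  gcongr
  simpa only [ENNReal.rpow_natCast] using hf.hausdorffMeasure_image_le (d := d) (by positivity)

theorem lipschitzOnWith_normalize {E : Type*} [NormedAddCommGroup E] [NormedSpace ℝ E]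
    {r : NNReal} (hr : 0 < r) :
    LipschitzOnWith (2 / r) (NormedSpace.normalize : E → E) {x | r ≤ ‖x‖} := by
  refine LipschitzOnWith.of_dist_le_mul fun x hx y hy => ?_
  have hx_pos : 0 < ‖x‖ := (NNReal.coe_pos.2 hr).trans_le hx
  have hy_pos : 0 < ‖y‖ := (NNReal.coe_pos.2 hr).trans_le hy
  have split : NormedSpace.normalize x - NormedSpace.normalize y =
      ‖x‖⁻¹ • ((x - y) + (‖y‖ - ‖x‖) • NormedSpace.normalize y) := by
    have hy_smul : ‖y‖ • NormedSpace.normalize y = y := NormedSpace.norm_smul_normalize y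
    rw [sub_smul, hy_smul, sub_add_sub_cancel, smul_sub, smul_smul, inv_mul_cancel₀ hx_pos.ne',
      one_smul, NormedSpace.normalize]
  have norm_normalize : ‖NormedSpace.normalize y‖ = 1 :=
    NormedSpace.norm_normalize_eq_one_iff.2 (norm_pos_iff.1 hy_pos)
  calc dist (NormedSpace.normalize x) (NormedSpace.normalize y)
      = ‖x‖⁻¹ * ‖(x - y) + (‖y‖ - ‖x‖) • NormedSpace.normalize y‖ := by
        rw [dist_eq_norm, split, norm_smul, norm_inv, norm_norm]
    _ ≤ ‖x‖⁻¹ * (‖x - y‖ + |‖y‖ - ‖x‖|) := by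
        gcongr
        refine (norm_add_le _ _).trans_eq ?_
        rw [norm_smul, norm_normalize, mul_one, Real.norm_eq_abs]
    _ ≤ (r : ℝ)⁻¹ * (‖x - y‖ + ‖x - y‖) := by
        gcongr
        · exact hx
        · rw [norm_sub_rev x y]
          exact abs_norm_sub_norm_le y x
    _ = (2 / r : NNReal) * dist x y := by
        rw [dist_eq_norm, NNReal.coe_div, NNReal.coe_ofNat]
        ring

theorem measure_normalize_image_eq_zero {E : Type*} [NormedAddCommGroup E] [NormedSpace ℝ E]
    [MeasurableSpace E] [BorelSpace E] {s : Set E} {r : NNReal} (hr : 0 < r)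
    (hs : s ⊆ {x | r ≤ ‖x‖}) {d : ℕ} (h : (μHE[d] : Measure E) s = 0) :
    (μHE[d] : Measure (Metric.sphere (0 : E) 1))
      {u | (u : E) ∈ NormedSpace.normalize '' s} = 0 := by
  rw [← isometry_subtype_coe.euclideanHausdorffMeasure_image]
  refine measure_mono_null (image_preimage_subset _ _) (nonpos_iff_eq_zero.1 ?_)
  simpa only [h, mul_zero]
    using euclideanHausdorffMeasure_image_le ((lipschitzOnWith_normalize hr).mono hs) d

end HausdorffMeasure

section Gnomonic

variable {E : Type*} [NormedAddCommGroup E] [InnerProductSpace ℝ E] (e : Metric.sphere (0 : E) 1)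

theorem inner_add_orthogonal (z : (ℝ ∙ (e : E))ᗮ) : ⟪(e : E), e + z⟫ = 1 := by
  rw [inner_add_right, Submodule.mem_orthogonal_singleton_iff_inner_right.1 z.2,
    real_inner_self_eq_norm_sq, norm_eq_of_mem_sphere, one_pow, add_zero]

theorem one_le_norm_add_orthogonal (z : (ℝ ∙ (e : E))ᗮ) : 1 ≤ ‖(e : E) + z‖ := by
  simpa only [inner_add_orthogonal, norm_eq_of_mem_sphere, one_mul] using
    real_inner_le_norm (e : E) (e + z)

theorem add_orthogonal_ne_zero (z : (ℝ ∙ (e : E))ᗮ) : (e : E) + z ≠ 0 :=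
  norm_pos_iff.1 (one_pos.trans_le (one_le_norm_add_orthogonal e z))

/-- The gnomonic projection from the centre of the unit sphere to the tangent hyperplane at `e`,
which is identified with `eᗮ`.  It is defined on all vectors, as a homogeneous function of degree
`0`, and is meaningful only where `⟪e, x⟫ ≠ 0`. -/
noncomputable def gnomonic (x : E) : (ℝ ∙ (e : E))ᗮ :=
  (ℝ ∙ (e : E))ᗮ.orthogonalProjectionOnto (⟪(e : E), x⟫⁻¹ • x)

/-- The inverse of the gnomonic projection: `e + z` is projected back to the unit sphere. -/
noncomputable def gnomonicInv (z : (ℝ ∙ (e : E))ᗮ) : Metric.sphere (0 : E) 1 :=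
  ⟨NormedSpace.normalize ((e : E) + z), mem_sphere_zero_iff_norm.2 <|
    NormedSpace.norm_normalize_eq_one_iff.2 (add_orthogonal_ne_zero e z)⟩

theorem coe_gnomonicInv (z : (ℝ ∙ (e : E))ᗮ) :
    (gnomonicInv e z : E) = NormedSpace.normalize ((e : E) + z) := rfl

theorem add_gnomonic {x : E} (hx : ⟪(e : E), x⟫ ≠ 0) :
    (e : E) + gnomonic e x = ⟪(e : E), x⟫⁻¹ • x := by
  rw [gnomonic, Submodule.coe_orthogonalProjectionOnto_apply,
    Submodule.starProjection_orthogonal_val, Submodule.starProjection_unit_singleton ℝ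
      (norm_eq_of_mem_sphere e), real_inner_smul_right, inv_mul_cancel₀ hx, one_smul,
    add_sub_cancel]

theorem gnomonicInv_gnomonic {u : Metric.sphere (0 : E) 1} (hu : 0 < ⟪(e : E), u⟫) :
    gnomonicInv e (gnomonic e u) = u := by
  ext1
  rw [coe_gnomonicInv, add_gnomonic e hu.ne', NormedSpace.normalize_smul_of_pos (inv_pos.2 hu),
    NormedSpace.normalize_eq_self_of_norm_eq_one (norm_eq_of_mem_sphere u)]

theorem gnomonic_gnomonicInv (z : (ℝ ∙ (e : E))ᗮ) : gnomonic e (gnomonicInv e z) = z := by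
  have norm_pos : 0 < ‖(e : E) + z‖ := norm_pos_iff.2 (add_orthogonal_ne_zero e z)
  have inner_eq : ⟪(e : E), gnomonicInv e z⟫ = ‖(e : E) + z‖⁻¹ := by
    rw [coe_gnomonicInv, NormedSpace.normalize, real_inner_smul_right, inner_add_orthogonal,
      mul_one]
  ext1
  apply add_left_cancel (a := (e : E))
  rw [add_gnomonic e (inner_eq ▸ (inv_pos.2 norm_pos).ne'), inner_eq, inv_inv, coe_gnomonicInv,
    NormedSpace.norm_smul_normalize]

theorem gnomonicInv_zero : gnomonicInv e 0 = e := by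
  ext1
  rw [coe_gnomonicInv, ZeroMemClass.coe_zero, add_zero,
    NormedSpace.normalize_eq_self_of_norm_eq_one (norm_eq_of_mem_sphere e)]

theorem lipschitzWith_gnomonicInv : LipschitzWith 2 (gnomonicInv e) := by
  refine LipschitzWith.of_dist_le_mul fun z w => ?_
  simpa only [div_one, NNReal.coe_ofNat, dist_add_left, Subtype.dist_eq, coe_gnomonicInv] using
    (lipschitzOnWith_normalize (E := E) one_pos).dist_le_mul _ (one_le_norm_add_orthogonal e z)
      _ (one_le_norm_add_orthogonal e w)

theorem contDiffAt_gnomonic : ContDiffAt ℝ 1 (gnomonic e) (e : E) := by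
  have inner_ne_zero : ⟪(e : E), (e : E)⟫ ≠ 0 :=
    inner_self_ne_zero.2 (ne_zero_of_mem_unit_sphere e)
  refine (ContinuousLinearMap.contDiff _).contDiffAt.comp _ ?_
  exact ((contDiffAt_const.inner ℝ contDiffAt_id).inv inner_ne_zero).smul contDiffAt_id

theorem openHemisphere_mem_nhds :
    {u : Metric.sphere (0 : E) 1 | 0 < ⟪(e : E), u⟫} ∈ 𝓝 e :=
  (isOpen_lt (by fun_prop) (by fun_prop)).mem_nhds <|
    real_inner_self_pos.2 (ne_zero_of_mem_unit_sphere e)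

end Gnomonic

section SphereMeasure

variable {E : Type*} [NormedAddCommGroup E] [InnerProductSpace ℝ E] [FiniteDimensional ℝ E]
  [MeasurableSpace E] [BorelSpace E]

theorem euclideanHausdorffMeasure_orthogonal (e : Metric.sphere (0 : E) 1) :
    (μHE[Module.finrank ℝ E - 1] : Measure (ℝ ∙ (e : E))ᗮ) = volume := by
  have finrank_orthogonal : Module.finrank ℝ (ℝ ∙ (e : E))ᗮ = Module.finrank ℝ E - 1 := by
    have h := (ℝ ∙ (e : E)).finrank_add_finrank_orthogonal
    rw [finrank_span_singleton (ne_zero_of_mem_unit_sphere e)] at h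
    omega
  rw [← finrank_orthogonal]
  exact InnerProductSpace.euclideanHausdorffMeasure_eq_volume

theorem sphere_measure_gnomonicInv_image_le (e : Metric.sphere (0 : E) 1)
    (T : Set (ℝ ∙ (e : E))ᗮ) :
    (μHE[Module.finrank ℝ E - 1] : Measure (Metric.sphere (0 : E) 1)) (gnomonicInv e '' T) ≤
      2 ^ (Module.finrank ℝ E - 1) * volume T := by
  simpa only [euclideanHausdorffMeasure_orthogonal, ENNReal.coe_ofNat] using
    euclideanHausdorffMeasure_image_le ((lipschitzWith_gnomonicInv e).lipschitzOnWith (s := T))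
      (Module.finrank ℝ E - 1)

theorem ae_sphere_of_forall_ae_gnomonicInv {p : Metric.sphere (0 : E) 1 → Prop}
    (h : ∀ e, ∀ᵐ z, p (gnomonicInv e z)) :
    ∀ᵐ u ∂(μHE[Module.finrank ℝ E - 1] : Measure (Metric.sphere (0 : E) 1)), p u := by
  refine measure_null_of_locally_null _ fun e _ => ?_
  refine ⟨_, inter_mem_nhdsWithin _ (openHemisphere_mem_nhds e), ?_⟩
  have subset_image : {u | ¬ p u} ∩ {u : Metric.sphere (0 : E) 1 | 0 < ⟪(e : E), u⟫} ⊆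
      gnomonicInv e '' {z | ¬ p (gnomonicInv e z)} := by
    rintro u ⟨hpu, hu⟩
    refine ⟨gnomonic e u, ?_, gnomonicInv_gnomonic e hu⟩
    rwa [mem_ofPred_eq, gnomonicInv_gnomonic e hu]
  refine measure_mono_null subset_image (le_antisymm ?_ zero_le)
  simpa only [ae_iff.1 (h e), mul_zero] using
    sphere_measure_gnomonicInv_image_le e {z | ¬ p (gnomonicInv e z)}

instance isFiniteMeasure_sphere :
    IsFiniteMeasure (μHE[Module.finrank ℝ E - 1] : Measure (Metric.sphere (0 : E) 1)) := by
  refine ⟨isCompact_univ.measure_lt_top_of_nhdsWithin fun e _ => ?_⟩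
  rw [nhdsWithin_univ]
  have continuousAt_gnomonic : ContinuousAt (fun u : Metric.sphere (0 : E) 1 => gnomonic e u) e :=
    (contDiffAt_gnomonic e).continuousAt.comp continuous_subtype_val.continuousAt
  refine ⟨_, inter_mem (openHemisphere_mem_nhds e)
    (continuousAt_gnomonic.preimage_mem_nhds (Metric.closedBall_mem_nhds _ one_pos)), ?_⟩
  refine (measure_mono ?_).trans_lt
    ((sphere_measure_gnomonicInv_image_le e (Metric.closedBall (gnomonic e e) 1)).trans_lt ?_)
  · exact fun u hu => ⟨gnomonic e u, hu.2, gnomonicInv_gnomonic e hu.1⟩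
  · exact ENNReal.mul_lt_top (ENNReal.pow_lt_top ENNReal.ofNat_lt_top) measure_closedBall_lt_top

instance isOpenPosMeasure_sphere :
    (μHE[Module.finrank ℝ E - 1] : Measure (Metric.sphere (0 : E) 1)).IsOpenPosMeasure := by
  refine ⟨fun U hU ⟨e, he⟩ hU_null => ?_⟩
  obtain ⟨C, t, ht, hC⟩ := (contDiffAt_gnomonic e).exists_lipschitzOnWith
  set s : Set (Metric.sphere (0 : E) 1) := U ∩ (↑) ⁻¹' t
  have hs : s ∈ 𝓝 (gnomonicInv e 0) := by
    rw [gnomonicInv_zero]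
    exact inter_mem (hU.mem_nhds he) (continuous_subtype_val.continuousAt.preimage_mem_nhds ht)
  have volume_pos : 0 < volume (gnomonicInv e ⁻¹' s) :=
    Measure.measure_pos_of_mem_nhds volume <|
      (lipschitzWith_gnomonicInv e).continuous.continuousAt hs
  have image_null : volume ((fun u : Metric.sphere (0 : E) 1 => gnomonic e u) '' s) = 0 := by
    have lipschitz : LipschitzOnWith (C * 1) (fun u : Metric.sphere (0 : E) 1 => gnomonic e u) s :=
      hC.comp (LipschitzWith.subtype_val _).lipschitzOnWith fun u hu => hu.2
    have image_le := euclideanHausdorffMeasure_image_le lipschitz (Module.finrank ℝ E - 1)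
    rw [euclideanHausdorffMeasure_orthogonal, measure_mono_null inter_subset_left hU_null,
      mul_zero] at image_le
    exact le_antisymm image_le zero_le
  refine volume_pos.not_ge ((measure_mono fun z hz => ?_).trans_eq image_null)
  exact ⟨gnomonicInv e z, hz, gnomonic_gnomonicInv e z⟩

end SphereMeasure

section UnitSphere

variable {n : ℕ}

instance isFiniteMeasure_sph : IsFiniteMeasure (μHE[n - 1] : Measure (Sph n)) := by
  simpa only [finrank_euclideanSpace_fin] using isFiniteMeasure_sphere (E := Euc n)

instance isOpenPosMeasure_sph : (μHE[n - 1] : Measure (Sph n)).IsOpenPosMeasure := by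
  simpa only [finrank_euclideanSpace_fin] using isOpenPosMeasure_sphere (E := Euc n)

end UnitSphere

variable {n : ℕ}

section Bodies

variable (K : BodyO n)

theorem body_mem_nhds_zero : (K.1 : Set (Euc n)) ∈ 𝓝 (0 : Euc n) :=
  mem_interior_iff_mem_nhds.1 K.2

theorem gauge_body_le_one_iff {x : Euc n} :
    gauge (K.1 : Set (Euc n)) x ≤ 1 ↔ x ∈ (K.1 : Set (Euc n)) := by
  rw [gauge_le_one_iff_mem_closure K.1.convex (body_mem_nhds_zero K), K.1.isClosed.closure_eq]

theorem gauge_body_eq_one_iff {x : Euc n} : gauge (K.1 : Set (Euc n)) x = 1 ↔ x ∈ bd K :=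
  gauge_eq_one_iff_mem_frontier K.1.convex (body_mem_nhds_zero K)

theorem gauge_body_pos {x : Euc n} (hx : x ≠ 0) : 0 < gauge (K.1 : Set (Euc n)) x :=
  (gauge_pos (absorbent_nhds_zero (body_mem_nhds_zero K))
    ((NormedSpace.isVonNBounded_iff ℝ).2 K.1.isBounded)).2 hx

theorem radial_eq_inv_gauge {x : Euc n} (hx : x ≠ 0) :
    radial K x = (gauge (K.1 : Set (Euc n)) x)⁻¹ := by
  have gauge_pos := gauge_body_pos K hx
  have scalings : {l : ℝ | 0 < l ∧ l • x ∈ (K.1 : Set (Euc n))} =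
      Ioc 0 (gauge (K.1 : Set (Euc n)) x)⁻¹ := by
    ext l
    refine and_congr_right fun hl => ?_
    rw [← gauge_body_le_one_iff, gauge_smul_of_nonneg hl.le, smul_eq_mul, ← one_div,
      le_div_iff₀ gauge_pos]
  rw [radial, scalings, csSup_Ioc (inv_pos.2 gauge_pos)]

theorem radial_coe_eq_inv_gauge (u : Sph n) : radial K u = (gauge (K.1 : Set (Euc n)) u)⁻¹ :=
  radial_eq_inv_gauge K (ne_zero_of_mem_unit_sphere u)

theorem radial_pos (u : Sph n) : 0 < radial K u := by
  rw [radial_coe_eq_inv_gauge]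
  exact inv_pos.2 (gauge_body_pos K (ne_zero_of_mem_unit_sphere u))

theorem radial_smul_mem_bd (u : Sph n) : radial K u • (u : Euc n) ∈ bd K := by
  rw [← gauge_body_eq_one_iff, gauge_smul_of_nonneg (radial_pos K u).le, radial_coe_eq_inv_gauge,
    smul_eq_mul, inv_mul_cancel₀ (gauge_body_pos K (ne_zero_of_mem_unit_sphere u)).ne']

theorem normalize_radial_smul (u : Sph n) :
    NormedSpace.normalize (radial K u • (u : Euc n)) = u := by
  rw [NormedSpace.normalize_smul_of_pos (radial_pos K u),
    NormedSpace.normalize_eq_self_of_norm_eq_one (norm_eq_of_mem_sphere u)]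

theorem ne_zero_of_mem_bd {x : Euc n} (hx : x ∈ bd K) : x ≠ 0 := by
  rintro rfl
  exact hx.2 K.2

theorem radial_smul_normalize_of_mem_bd {x : Euc n} (hx : x ∈ bd K) :
    radial K (NormedSpace.normalize x) • NormedSpace.normalize x = x := by
  have hx_zero := ne_zero_of_mem_bd K hx
  rw [radial_eq_inv_gauge K (NormedSpace.normalize_eq_zero_iff x |>.not.2 hx_zero),
    NormedSpace.normalize, gauge_smul_of_nonneg (by positivity), (gauge_body_eq_one_iff K).2 hx,
    smul_eq_mul, mul_one, inv_inv, smul_inv_smul₀ (norm_ne_zero_iff.2 hx_zero)]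

theorem exists_pos_forall_le_norm_of_mem_bd :
    ∃ r : NNReal, 0 < r ∧ bd K ⊆ {x | r ≤ ‖x‖} := by
  obtain ⟨r, hr, ball_subset⟩ := Metric.mem_nhds_iff.1 (isOpen_interior.mem_nhds K.2)
  refine ⟨⟨r, hr.le⟩, hr, fun x hx => ?_⟩
  exact le_of_not_gt fun hxr => hx.2 (ball_subset (mem_ball_zero_iff.2 hxr))

theorem inner_le_supp (v : Euc n) {x : Euc n} (hx : x ∈ (K.1 : Set (Euc n))) :
    ⟪v, x⟫ ≤ supp K v :=
  le_csSup (supp_bddAbove K v) (mem_image_of_mem _ hx)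

theorem supp_le (v : Euc n) {c : ℝ} (h : ∀ x ∈ (K.1 : Set (Euc n)), ⟪v, x⟫ ≤ c) :
    supp K v ≤ c :=
  csSup_le (K.1.nonempty.image _) (forall_mem_image.2 h)

theorem supp_pos (v : Sph n) : 0 < supp K v := by
  refine (radial_pos K v).trans_le ?_
  simpa only [real_inner_smul_right, real_inner_self_eq_norm_sq, norm_eq_of_mem_sphere, one_pow,
    mul_one] using inner_le_supp K v (bd_subset K (radial_smul_mem_bd K v))

theorem radialNormals_singleton (u : Sph n) :
    radialNormals K {u} = normals K {radial K u • (u : Euc n)} := by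
  rw [radialNormals, image_singleton]

theorem radialNormals_nonempty (u : Sph n) : (radialNormals K {u}).Nonempty := by
  rw [radialNormals_singleton]
  exact normals_nonempty K (radial_smul_mem_bd K u)

variable {K}

theorem mem_radialNormals_iff {u v : Sph n} :
    v ∈ radialNormals K {u} ↔ radial K u * ⟪(v : Euc n), u⟫ = supp K v := by
  simp [radialNormals, normals, hyperplane, real_inner_smul_right]

theorem mem_reverseRadial_iff {A : Set (Sph n)} {u : Sph n} :
    u ∈ reverseRadial K A ↔ ∃ v ∈ A, v ∈ radialNormals K {u} := by
  simp only [radialNormals_singleton, normals, mem_singleton_iff, exists_eq_left, mem_ofPred_eq]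
  constructor
  · rintro ⟨x, ⟨hx, v, hvA, hxv⟩, hu⟩
    rw [← NormedSpace.normalize] at hu
    refine ⟨v, hvA, ?_⟩
    rwa [hu, radial_smul_normalize_of_mem_bd K hx]
  · rintro ⟨v, hvA, huv⟩
    exact ⟨_, ⟨radial_smul_mem_bd K u, v, hvA, huv⟩, (normalize_radial_smul K u).symm⟩

theorem inner_pos_of_mem_radialNormals {u v : Sph n} (hv : v ∈ radialNormals K {u}) :
    0 < ⟪(v : Euc n), (u : Euc n)⟫ :=
  pos_of_mul_pos_right (mem_radialNormals_iff.1 hv ▸ supp_pos K v) (radial_pos K u).le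

theorem radialGauss_eq_of_radialNormals_eq {u v : Sph n} (h : radialNormals K {u} = {v}) :
    radialGauss K u = v := by
  have h_exists : ∃ w, radialNormals K {u} = {w} := ⟨v, h⟩
  rw [radialGauss, dif_pos h_exists]
  exact singleton_injective (h_exists.choose_spec.symm.trans h)

end Bodies

section Polar

/-- The boundary point `v / h_K(v)` of the polar body of `K` in the direction `v`.  Since
`h_K(v) > 0`, the pairing with it is the linear minorant of the gauge of `K` belonging to the
supporting hyperplane with normal `v`. -/
noncomputable def polarPoint (K : BodyO n) (v : Sph n) : Euc n := (supp K v)⁻¹ • (v : Euc n)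

variable {K : BodyO n}

theorem polarPoint_injective : Function.Injective (polarPoint K) := by
  have normalize_polarPoint (v : Sph n) : NormedSpace.normalize (polarPoint K v) = v := by
    rw [polarPoint, NormedSpace.normalize_smul_of_pos (inv_pos.2 (supp_pos K v)),
      NormedSpace.normalize_eq_self_of_norm_eq_one (norm_eq_of_mem_sphere v)]
  intro v w h
  ext1
  rw [← normalize_polarPoint v, h, normalize_polarPoint]

theorem inner_polarPoint_le_gauge (v : Sph n) (x : Euc n) :
    ⟪polarPoint K v, x⟫ ≤ gauge (K.1 : Set (Euc n)) x := by
  rcases eq_or_ne x 0 with rfl | hx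
  · rw [inner_zero_right, gauge_zero]
  have gauge_pos := gauge_body_pos K hx
  have mem_body : (gauge (K.1 : Set (Euc n)) x)⁻¹ • x ∈ (K.1 : Set (Euc n)) := by
    rw [← gauge_body_le_one_iff, gauge_smul_of_nonneg (inv_pos.2 gauge_pos).le, smul_eq_mul,
      inv_mul_cancel₀ gauge_pos.ne']
  have inner_le := inner_le_supp K v mem_body
  rw [real_inner_smul_right, inv_mul_le_iff₀ gauge_pos] at inner_le
  rwa [polarPoint, real_inner_smul_left, inv_mul_le_iff₀ (supp_pos K v), mul_comm]

theorem mem_radialNormals_iff_inner_polarPoint {u v : Sph n} :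
    v ∈ radialNormals K {u} ↔ ⟪polarPoint K v, u⟫ = gauge (K.1 : Set (Euc n)) u := by
  have gauge_pos := gauge_body_pos K (ne_zero_of_mem_unit_sphere u)
  have supp_pos := supp_pos K v
  rw [mem_radialNormals_iff, radial_coe_eq_inv_gauge, polarPoint, real_inner_smul_left,
    inv_mul_eq_iff_eq_mul₀ gauge_pos.ne', inv_mul_eq_iff_eq_mul₀ supp_pos.ne', mul_comm]

end Polar

section Differentiability

theorem hasFDerivAt_eq_of_eventually_le {F : Type*} [NormedAddCommGroup F] [NormedSpace ℝ F]
    {f g : F → ℝ} {f' g' : F →L[ℝ] ℝ} {z : F} (hg : HasFDerivAt g g' z) (hf : HasFDerivAt f f' z)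
    (h_le : g ≤ᶠ[𝓝 z] f) (h_eq : g z = f z) : g' = f' := by
  have isLocalMin : IsLocalMin (f - g) z := by
    filter_upwards [h_le] with w hw
    simpa only [Pi.sub_apply, h_eq, sub_self] using sub_nonneg.2 hw
  exact (sub_eq_zero.1 (isLocalMin.hasFDerivAt_eq_zero (hf.sub hg))).symm

variable {K : BodyO n}

theorem radialNormals_subsingleton_of_differentiableAt {e : Sph n} {z : (ℝ ∙ (e : Euc n))ᗮ}
    (h : DifferentiableAt ℝ
      (fun w : (ℝ ∙ (e : Euc n))ᗮ => gauge (K.1 : Set (Euc n)) ((e : Euc n) + w)) z) :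
    (radialNormals K {gnomonicInv e z}).Subsingleton := by
  set ez : Euc n := (e : Euc n) + z
  have norm_pos : 0 < ‖ez‖ := norm_pos_iff.2 (add_orthogonal_ne_zero e z)
  have touch {v : Sph n} (hv : v ∈ radialNormals K {gnomonicInv e z}) :
      ⟪polarPoint K v, ez⟫ = gauge (K.1 : Set (Euc n)) ez := by
    rw [mem_radialNormals_iff_inner_polarPoint, coe_gnomonicInv, NormedSpace.normalize,
      real_inner_smul_right, gauge_smul_of_nonneg (inv_pos.2 norm_pos).le, smul_eq_mul] at hv
    exact mul_left_cancel₀ (inv_pos.2 norm_pos).ne' hv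
  have derivative {v : Sph n} (hv : v ∈ radialNormals K {gnomonicInv e z})
      (w : (ℝ ∙ (e : Euc n))ᗮ) : ⟪polarPoint K v, w⟫ = fderiv ℝ
        (fun y : (ℝ ∙ (e : Euc n))ᗮ => gauge (K.1 : Set (Euc n)) ((e : Euc n) + y)) z w := by
    have hasFDerivAt_inner := ((innerSL ℝ (polarPoint K v)).hasFDerivAt (x := ez)).comp z
      ((ℝ ∙ (e : Euc n))ᗮ.subtypeL.hasFDerivAt.const_add (e : Euc n))
    exact congrArg (· w) (hasFDerivAt_eq_of_eventually_le hasFDerivAt_inner h.hasFDerivAt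
      (.of_forall fun w => inner_polarPoint_le_gauge v _) (touch hv))
  intro v hv w hw
  refine polarPoint_injective (K := K) (sub_eq_zero.1 ?_)
  set d : Euc n := polarPoint K v - polarPoint K w
  have inner_orthogonal (y : (ℝ ∙ (e : Euc n))ᗮ) : ⟪d, y⟫ = 0 := by
    rw [inner_sub_left, derivative hv, derivative hw, sub_self]
  have inner_ez : ⟪d, ez⟫ = 0 := by rw [inner_sub_left, touch hv, touch hw, sub_self]
  have d_mem : d ∈ (ℝ ∙ (e : Euc n))ᗮ := by
    rw [inner_add_right, inner_orthogonal z, add_zero] at inner_ez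
    exact Submodule.mem_orthogonal_singleton_iff_inner_left.2 inner_ez
  exact inner_self_eq_zero.1 (inner_orthogonal ⟨d, d_mem⟩)

theorem ae_radialNormals_eq_singleton (K : BodyO n) :
    ∀ᵐ u ∂(μHE[n - 1] : Measure (Sph n)), ∃ v, radialNormals K {u} = {v} := by
  have ae_subsingleton : ∀ᵐ u ∂(μHE[Module.finrank ℝ (Euc n) - 1] : Measure (Sph n)),
      (radialNormals K {u}).Subsingleton := by
    refine ae_sphere_of_forall_ae_gnomonicInv fun e => ?_
    obtain ⟨C, hC⟩ := K.1.convex.lipschitz_gauge (body_mem_nhds_zero K)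
    have isometry_add : Isometry fun z : (ℝ ∙ (e : Euc n))ᗮ => (e : Euc n) + z :=
      (isometry_add_left (e : Euc n)).comp isometry_subtype_coe
    filter_upwards [(hC.comp isometry_add.lipschitz).ae_differentiableAt] with z hz
    exact radialNormals_subsingleton_of_differentiableAt hz
  rw [finrank_euclideanSpace_fin] at ae_subsingleton
  filter_upwards [ae_subsingleton] with u hu
  exact exists_eq_singleton_iff_nonempty_subsingleton.2 ⟨radialNormals_nonempty K u, hu⟩

theorem ae_radialNormals_eq_radialGauss (K : BodyO n) :
    ∀ᵐ u ∂(μHE[n - 1] : Measure (Sph n)), radialNormals K {u} = {radialGauss K u} := by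
  filter_upwards [ae_radialNormals_eq_singleton K] with u ⟨v, hv⟩
  rw [radialGauss_eq_of_radialNormals_eq hv, hv]

end Differentiability

section Hemicontinuity

variable {X Y : Type*} [TopologicalSpace X] [TopologicalSpace Y] {f : X → Set Y}

theorem upperHemicontinuous_of_isClosed_graph [CompactSpace Y]
    (hf : IsClosed {p : X × Y | p.2 ∈ f p.1}) : UpperHemicontinuous f := by
  refine upperHemicontinuous_iff_isClosed_compl_preimage_Iic_compl.2 fun C hC => ?_
  convert! isClosedMap_fst_of_compactSpace _ (hf.inter (hC.preimage continuous_snd)) using 1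
  ext x
  simp [Set.subset_def]

theorem continuousOn_of_eq_singleton {g : X → Y} {s : Set X} (hf : UpperHemicontinuous f)
    (h_eq : ∀ x ∈ s, f x = {g x}) : ContinuousOn g s :=
  upperHemicontinuousOn_singleton_iff.1 fun x hx =>
    (hf.upperHemicontinuousWithinAt s x).congr_of_eventuallyEq hx
      (eventually_mem_nhdsWithin.mono h_eq)

end Hemicontinuity

section JointContinuity

theorem supp_le_supp_add_dist (K L : BodyO n) (v : Sph n) : supp K v ≤ supp L v + dist K L := by
  refine supp_le K v fun x hx => le_of_forall_pos_le_add fun ε hε => ?_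
  have hausdorffDist_lt : Metric.hausdorffDist (K.1 : Set (Euc n)) L.1 < dist K L + ε := by
    rw [ConvexBody.hausdorffDist_coe, ← Subtype.dist_eq]
    exact lt_add_of_pos_right _ hε
  obtain ⟨y, hy, hxy⟩ := Metric.exists_dist_lt_of_hausdorffDist_lt hx hausdorffDist_lt
    ConvexBody.hausdorffEDist_ne_top
  have inner_sub_le : ⟪(v : Euc n), x - y⟫ ≤ dist x y := by
    simpa only [norm_eq_of_mem_sphere, one_mul, dist_eq_norm]
      using real_inner_le_norm (v : Euc n) (x - y)
  rw [inner_sub_right] at inner_sub_le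
  linarith [inner_le_supp L v hy]

theorem continuous_supp : Continuous fun p : BodyO n × Sph n => supp p.1 p.2 := by
  refine continuous_prod_of_continuous_lipschitzWith _ 1 (fun K => ?_) fun v => ?_
  · exact K.1.isCompact.continuous_sSup (f := fun (u : Sph n) (x : Euc n) => ⟪(u : Euc n), x⟫)
      (by fun_prop)
  · exact LipschitzWith.of_le_add fun K L => supp_le_supp_add_dist K L v

theorem continuous_polarPoint : Continuous fun p : BodyO n × Sph n => polarPoint p.1 p.2 :=
  (continuous_supp.inv₀ fun p => (supp_pos p.1 p.2).ne').smul
    (continuous_subtype_val.comp continuous_snd)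

theorem gauge_eq_sSup_inner_polarPoint (K : BodyO n) (u : Sph n) :
    gauge (K.1 : Set (Euc n)) u = sSup ((fun v => ⟪polarPoint K v, (u : Euc n)⟫) '' univ) := by
  obtain ⟨v, hv⟩ := radialNormals_nonempty K u
  have isGreatest : IsGreatest ((fun v => ⟪polarPoint K v, (u : Euc n)⟫) '' univ)
      (gauge (K.1 : Set (Euc n)) u) := by
    refine ⟨⟨v, mem_univ v, mem_radialNormals_iff_inner_polarPoint.1 hv⟩, ?_⟩
    rintro _ ⟨w, -, rfl⟩
    exact inner_polarPoint_le_gauge w u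
  exact isGreatest.csSup_eq.symm

theorem continuous_radial : Continuous fun p : BodyO n × Sph n => radial p.1 p.2 := by
  have continuous_gauge :
      Continuous fun p : BodyO n × Sph n => gauge (p.1.1 : Set (Euc n)) p.2 := by
    simp_rw [gauge_eq_sSup_inner_polarPoint]
    refine isCompact_univ.continuous_sSup
      (f := fun (p : BodyO n × Sph n) v => ⟪polarPoint p.1 v, (p.2 : Euc n)⟫) ?_
    exact (continuous_polarPoint.comp (by fun_prop : Continuous
      fun q : (BodyO n × Sph n) × Sph n => (q.1.1, q.2))).inner (by fun_prop)
  simp_rw [radial_coe_eq_inv_gauge]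
  exact continuous_gauge.inv₀ fun p => (gauge_body_pos p.1 (ne_zero_of_mem_unit_sphere p.2)).ne'

theorem upperHemicontinuous_radialNormals :
    UpperHemicontinuous fun p : BodyO n × Sph n => radialNormals p.1 {p.2} := by
  refine upperHemicontinuous_of_isClosed_graph ?_
  simp_rw [mem_radialNormals_iff]
  exact isClosed_eq ((continuous_radial.comp continuous_fst).mul (by fun_prop))
    (continuous_supp.comp (by fun_prop : Continuous
      fun q : (BodyO n × Sph n) × Sph n => (q.1.1, q.2)))

theorem continuousOn_radialGauss : ContinuousOn (fun p : BodyO n × Sph n => radialGauss p.1 p.2)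
    {p | radialNormals p.1 {p.2} = {radialGauss p.1 p.2}} :=
  continuousOn_of_eq_singleton upperHemicontinuous_radialNormals fun _ hp => hp

theorem eventually_inner_pos_of_mem_radialNormals (K : BodyO n) (v : Sph n) :
    ∀ᶠ u in 𝓝 v, ∀ w ∈ radialNormals K {u}, 0 < ⟪(w : Euc n), (v : Euc n)⟫ :=
  (upperHemicontinuous_radialNormals.comp (by fun_prop : Continuous fun u : Sph n => (K, u)))
    |>.forall_isOpen v {w | 0 < ⟪(w : Euc n), (v : Euc n)⟫}
      (isOpen_lt continuous_const (by fun_prop)) fun _ hw => inner_pos_of_mem_radialNormals hw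

end JointContinuity

section RadialGaussIntegral

theorem aemeasurable_radialGauss (K : BodyO n) :
    AEMeasurable (radialGauss K) (μHE[n - 1] : Measure (Sph n)) := by
  obtain ⟨M, M_subset, hM, ae_mem_M⟩ := (ae_radialNormals_eq_radialGauss K).exists_measurable_mem
  have continuousOn_M : ContinuousOn (radialGauss K) M :=
    continuousOn_radialGauss.comp (f := fun u => (K, u)) (by fun_prop) ae_mem_M
  rw [← Measure.restrict_eq_self_of_ae_mem M_subset]
  exact continuousOn_M.aemeasurable hM

theorem reverseRadial_ae_eq (K : BodyO n) (A : Set (Sph n)) :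
    reverseRadial K A =ᵐ[μHE[n - 1]] radialGauss K ⁻¹' A := by
  filter_upwards [ae_radialNormals_eq_radialGauss K] with u hu
  refine propext ((mem_reverseRadial_iff (A := A)).trans ?_)
  rw [hu]
  exact exists_eq_right

theorem tendsto_radialGauss {L : ℕ → BodyO n} {K : BodyO n} (hL : Tendsto L atTop (𝓝 K))
    {u : Sph n} (huL : ∀ i, radialNormals (L i) {u} = {radialGauss (L i) u})
    (huK : radialNormals K {u} = {radialGauss K u}) :
    Tendsto (fun i => radialGauss (L i) u) atTop (𝓝 (radialGauss K u)) := by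
  have tendsto_within : Tendsto (fun i => (L i, u)) atTop
      (𝓝[{p : BodyO n × Sph n | radialNormals p.1 {p.2} = {radialGauss p.1 p.2}}] (K, u)) :=
    tendsto_nhdsWithin_iff.2 ⟨hL.prodMk_nhds tendsto_const_nhds, .of_forall huL⟩
  simpa only [Function.comp_def]
    using (continuousOn_radialGauss (K, u) huK).tendsto.comp tendsto_within

theorem ae_tendsto_radialGauss {L : ℕ → BodyO n} {K : BodyO n} (hL : Tendsto L atTop (𝓝 K)) :
    ∀ᵐ u ∂(μHE[n - 1] : Measure (Sph n)),
      Tendsto (fun i => radialGauss (L i) u) atTop (𝓝 (radialGauss K u)) := by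
  filter_upwards [ae_radialNormals_eq_radialGauss K,
    ae_all_iff.2 fun i => ae_radialNormals_eq_radialGauss (L i)] with u huK huL
  exact tendsto_radialGauss hL huL huK

theorem integrable_comp_radialGauss (K : BodyO n) {h : Sph n × Sph n → ℝ} (hh : Continuous h) :
    Integrable (fun u => h (u, radialGauss K u)) (μHE[n - 1] : Measure (Sph n)) := by
  obtain ⟨C, hC⟩ := isCompact_univ.exists_bound_of_continuousOn hh.continuousOn
  exact .of_bound (hh.measurable.comp_aemeasurable
    (aemeasurable_id.prodMk (aemeasurable_radialGauss K))).aestronglyMeasurable C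
    (.of_forall fun _ => hC _ (mem_univ _))

theorem continuous_integral_comp_radialGauss {h : BodyO n × Sph n × Sph n → ℝ}
    (hh : Continuous h) :
    Continuous fun K => ∫ u, h (K, u, radialGauss K u) ∂(μHE[n - 1] : Measure (Sph n)) := by
  refine continuous_iff_seqContinuous.2 fun L K hL => ?_
  obtain ⟨C, hC⟩ := (hL.isCompact_insert_range.prod isCompact_univ).exists_bound_of_continuousOn
    hh.continuousOn
  refine tendsto_integral_of_dominated_convergence (fun _ => C) (fun i => ?_)
    (integrable_const C) (fun i => .of_forall fun u => ?_) ?_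
  · exact (integrable_comp_radialGauss (L i)
      (hh.comp (by fun_prop : Continuous fun q : Sph n × Sph n => (L i, q)))).aestronglyMeasurable
  · exact hC _ ⟨mem_insert_of_mem K (mem_range_self i), mem_univ _⟩
  · filter_upwards [ae_tendsto_radialGauss hL] with u hu
    exact (hh.tendsto _).comp (hL.prodMk_nhds (tendsto_const_nhds.prodMk_nhds hu))

end RadialGaussIntegral

section SignedMeasure

variable {X Y : Type*} [MeasurableSpace X] [MeasurableSpace Y] {σ : Measure X} {a : X → Y}
  {f : X → ℝ}

theorem integral_smul_toSignedMeasure (μ : Measure Y) [IsFiniteMeasure μ] (g : Y → ℝ) :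
    ∫ᵛ y, g y ∂•μ.toSignedMeasure = ∫ y, g y ∂μ := by
  have lsmul_eq_flip :
      ContinuousLinearMap.lsmul ℝ ℝ (E := ℝ) = (ContinuousLinearMap.lsmul ℝ ℝ).flip := by
    ext
    simp
  rw [lsmul_eq_flip, VectorMeasure.integral_toSignedMeasure]

theorem integral_withDensity_ofReal (hf : Integrable f σ) (g : X → ℝ) :
    ∫ x, g x ∂σ.withDensity (fun x => ENNReal.ofReal (f x)) = ∫ x, g x * max (f x) 0 ∂σ := by
  rw [integral_withDensity_eq_integral_toReal_smul₀ hf.aemeasurable.ennreal_ofReal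
    (.of_forall fun _ => ENNReal.ofReal_lt_top)]
  simp only [ENNReal.toReal_ofReal', smul_eq_mul, mul_comm]

theorem integrable_toSignedMeasure_withDensity_ofReal {g : X → ℝ}
    [IsFiniteMeasure (σ.withDensity fun x => ENNReal.ofReal (f x))]
    (hg : AEStronglyMeasurable g σ) {c : ℝ} (hgc : ∀ x, ‖g x‖ ≤ c) :
    (σ.withDensity fun x => ENNReal.ofReal (f x)).toSignedMeasure.Integrable g := by
  rw [VectorMeasure.Integrable, Measure.variation_toSignedMeasure]
  exact .of_bound (hg.mono_ac (withDensity_absolutelyContinuous _ _)) c (.of_forall hgc)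

theorem integral_withDensityᵥ (hf : Integrable f σ) {g : X → ℝ} (hg : AEStronglyMeasurable g σ)
    {c : ℝ} (hgc : ∀ x, ‖g x‖ ≤ c) :
    ∫ᵛ x, g x ∂•(σ.withDensityᵥ f) = ∫ x, g x * f x ∂σ := by
  have hf_neg : Integrable (fun x => -f x) σ := hf.neg
  have := isFiniteMeasure_withDensity_ofReal hf.hasFiniteIntegral
  have := isFiniteMeasure_withDensity_ofReal hf_neg.hasFiniteIntegral
  rw [withDensityᵥ_eq_withDensity_pos_part_sub_withDensity_neg_part hf,
    VectorMeasure.integral_sub_vectorMeasure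
      (integrable_toSignedMeasure_withDensity_ofReal hg hgc)
      (integrable_toSignedMeasure_withDensity_ofReal hg hgc),
    integral_smul_toSignedMeasure, integral_smul_toSignedMeasure, integral_withDensity_ofReal hf,
    integral_withDensity_ofReal hf_neg,
    ← integral_sub (hf.pos_part.bdd_mul hg (.of_forall hgc))
      (hf_neg.pos_part.bdd_mul hg (.of_forall hgc))]
  simp only [← mul_sub, max_zero_sub_max_neg_zero_eq_self]

theorem map_withDensityᵥ_apply (ha : AEMeasurable a σ) (hf : Integrable f σ) {A : Set Y}
    (hA : MeasurableSet A) :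
    (σ.withDensityᵥ f).map (ha.mk a) A = ∫ x in a ⁻¹' A, f x ∂σ := by
  rw [VectorMeasure.map_apply _ ha.measurable_mk hA,
    withDensityᵥ_apply hf (ha.measurable_mk hA)]
  exact setIntegral_congr_set (ha.ae_eq_mk.symm.preimage A)

theorem integral_map_withDensityᵥ (ha : AEMeasurable a σ) (hf : Integrable f σ)
    {g : Y → ℝ} (hg : Measurable g) {c : ℝ} (hgc : ∀ y, ‖g y‖ ≤ c) :
    ∫ᵛ y, g y ∂•((σ.withDensityᵥ f).map (ha.mk a)) = ∫ x, g (a x) * f x ∂σ := by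
  have hga : Measurable (g ∘ ha.mk a) := hg.comp ha.measurable_mk
  have integrable_comp : (σ.withDensityᵥ f).Integrable (g ∘ ha.mk a) := by
    have := isFiniteMeasure_withDensity hf.2.ne
    rw [VectorMeasure.Integrable, Measure.variation_withDensityᵥ hf]
    exact .of_bound hga.aestronglyMeasurable c (.of_forall fun x => hgc _)
  rw [VectorMeasure.integral_map ha.measurable_mk hg.aestronglyMeasurable integrable_comp]
  refine (integral_withDensityᵥ hf hga.aestronglyMeasurable fun x => hgc _).trans ?_
  refine integral_congr_ae ?_
  filter_upwards [ha.ae_eq_mk] with x hx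
  rw [hx, Function.comp_apply]

theorem exists_finiteMeasure_toSignedMeasure_eq {C : SignedMeasure Y} (hC : 0 ≤ C) :
    ∃ μ : FiniteMeasure Y, (μ : Measure Y).toSignedMeasure = C := by
  have nonneg_univ : 0 ≤[univ] C := (VectorMeasure.le_restrict_univ_iff_le _ _).2 hC
  exact ⟨⟨C.toMeasureOfZeroLE univ .univ nonneg_univ, inferInstance⟩,
    C.toMeasureOfZeroLE_toSignedMeasure nonneg_univ⟩

end SignedMeasure

variable {G : ℝ → Sph n → ℝ} {ψ : ℝ → ℝ}

section CurvatureMeasure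

/-- The integrand `ρ_K(u) G_t(ρ_K(u), u) / ψ(h_K(v))` of the dual Orlicz curvature measure as a
function of `(K, u, v)`. The normal `v`, equal to `α_K(u)` in `density`, is kept as a separate
variable because the integrand is jointly continuous only in this form. -/
noncomputable def densityKernel (G : ℝ → Sph n → ℝ) (ψ : ℝ → ℝ)
    (p : BodyO n × Sph n × Sph n) : ℝ :=
  radial p.1 p.2.1 * deriv (fun t => G t p.2.1) (radial p.1 p.2.1) / ψ (supp p.1 p.2.2)

theorem continuous_densityKernel
    (hGt : ContinuousOn (fun p : ℝ × Sph n => deriv (fun s => G s p.2) p.1) (Ioi 0 ×ˢ univ))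
    (hψ : ContinuousOn ψ (Ioi 0)) (hψpos : ∀ t : ℝ, 0 < t → 0 < ψ t) :
    Continuous (densityKernel G ψ) := by
  have continuous_radial_kernel :
      Continuous fun p : BodyO n × Sph n × Sph n => radial p.1 p.2.1 :=
    continuous_radial.comp (by fun_prop : Continuous
      fun p : BodyO n × Sph n × Sph n => (p.1, p.2.1))
  have continuous_supp_kernel : Continuous fun p : BodyO n × Sph n × Sph n => supp p.1 p.2.2 :=
    continuous_supp.comp (by fun_prop : Continuous
      fun p : BodyO n × Sph n × Sph n => (p.1, p.2.2))
  have continuous_deriv : Continuous fun p : BodyO n × Sph n × Sph n =>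
      deriv (fun t => G t p.2.1) (radial p.1 p.2.1) :=
    hGt.comp_continuous (continuous_radial_kernel.prodMk continuous_snd.fst)
      fun p => ⟨radial_pos p.1 p.2.1, mem_univ _⟩
  exact (continuous_radial_kernel.mul continuous_deriv).div
    (hψ.comp_continuous continuous_supp_kernel fun p => supp_pos p.1 p.2.2)
    fun p => (hψpos _ (supp_pos p.1 p.2.2)).ne'

theorem integrable_density (h_cont : Continuous (densityKernel G ψ)) (K : BodyO n) :
    Integrable (density G ψ K) (μHE[n - 1] : Measure (Sph n)) :=
  integrable_comp_radialGauss K (h := fun q => densityKernel G ψ (K, q)) (by fun_prop)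

theorem curvatureValue_eq_setIntegral (K : BodyO n) (A : Set (Sph n)) :
    curvatureValue G ψ K A = ∫ u in radialGauss K ⁻¹' A, 1 / (n : ℝ) * density G ψ K u
      ∂(μHE[n - 1] : Measure (Sph n)) := by
  rw [curvatureValue, setIntegral_congr_set (reverseRadial_ae_eq K A), integral_const_mul]

theorem curvatureMeasure_eq_of_forall_apply {K : BodyO n} {C : SignedMeasure (Sph n)}
    (hC : ∀ A, MeasurableSet A → C A = curvatureValue G ψ K A) : curvatureMeasure G ψ K = C := by
  have h_exists : ∃ C : SignedMeasure (Sph n),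
      ∀ A, MeasurableSet A → C A = curvatureValue G ψ K A := ⟨C, hC⟩
  rw [curvatureMeasure, dif_pos h_exists]
  exact VectorMeasure.ext fun A hA => (h_exists.choose_spec A hA).trans (hC A hA).symm

theorem curvatureMeasure_eq_map {K : BodyO n}
    (h_int : Integrable (density G ψ K) (μHE[n - 1] : Measure (Sph n))) :
    curvatureMeasure G ψ K =
      ((μHE[n - 1] : Measure (Sph n)).withDensityᵥ fun u => 1 / (n : ℝ) * density G ψ K u).map
        ((aemeasurable_radialGauss K).mk (radialGauss K)) :=
  curvatureMeasure_eq_of_forall_apply fun A hA =>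
    (map_withDensityᵥ_apply _ (h_int.const_mul _) hA).trans
      (curvatureValue_eq_setIntegral K A).symm

theorem curvatureMeasure_apply {K : BodyO n}
    (h_int : Integrable (density G ψ K) (μHE[n - 1] : Measure (Sph n))) {A : Set (Sph n)}
    (hA : MeasurableSet A) : curvatureMeasure G ψ K A = curvatureValue G ψ K A := by
  rw [curvatureMeasure_eq_map h_int, map_withDensityᵥ_apply _ (h_int.const_mul _) hA,
    curvatureValue_eq_setIntegral]

theorem integral_curvatureMeasure {K : BodyO n}
    (h_int : Integrable (density G ψ K) (μHE[n - 1] : Measure (Sph n))) {g : Sph n → ℝ}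
    (hg : Continuous g) :
    ∫ᵛ u, g u ∂•(curvatureMeasure G ψ K) =
      ∫ u, g (radialGauss K u) * (1 / (n : ℝ) * density G ψ K u)
        ∂(μHE[n - 1] : Measure (Sph n)) := by
  obtain ⟨c, hc⟩ := isCompact_univ.exists_bound_of_continuousOn hg.continuousOn
  rw [curvatureMeasure_eq_map h_int]
  exact integral_map_withDensityᵥ _ (h_int.const_mul _) hg.measurable fun v => hc v (mem_univ v)

end CurvatureMeasure

section AbsoluteContinuity

theorem radial_smul_mem_reg {K : BodyO n} {u : Sph n}
    (hu : radialNormals K {u} = {radialGauss K u}) :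
    ∃ h : radial K u • (u : Euc n) ∈ reg K, gauss K ⟨_, h⟩ = radialGauss K u := by
  rw [radialNormals_singleton] at hu
  have h_reg : radial K u • (u : Euc n) ∈ reg K :=
    ⟨radial_smul_mem_bd K u, fun h => not_nontrivial_singleton (hu ▸ h.2)⟩
  exact ⟨h_reg, singleton_injective ((gauss_spec K ⟨_, h_reg⟩).symm.trans hu)⟩

theorem reverseRadial_null_of_surfaceArea_null (K : BodyO n) {A : Set (Sph n)}
    (hA : MeasurableSet A) (h : surfaceArea K A = 0) :
    (μHE[n - 1] : Measure (Sph n)) (reverseRadial K A) = 0 := by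
  rw [surfaceArea_apply K hA] at h
  obtain ⟨r, hr, hr_bd⟩ := exists_pos_forall_le_norm_of_mem_bd K
  have normalize_null :=
    measure_normalize_image_eq_zero hr (fun x hx => hr_bd hx.choose.1) h
  rw [measure_congr (reverseRadial_ae_eq K A)]
  refine measure_mono_null_ae ?_ normalize_null
  filter_upwards [ae_radialNormals_eq_radialGauss K] with u hu huA
  obtain ⟨h_reg, h_gauss⟩ := radial_smul_mem_reg hu
  exact ⟨_, ⟨h_reg, h_gauss ▸ huA⟩, normalize_radial_smul K u⟩

theorem curvatureMeasure_absolutelyContinuous {K : BodyO n}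
    (h_int : Integrable (density G ψ K) (μHE[n - 1] : Measure (Sph n))) :
    curvatureMeasure G ψ K ≪ᵥ (surfaceArea K).toENNRealVectorMeasure := by
  refine VectorMeasure.AbsolutelyContinuous.mk fun A hA h => ?_
  rw [Measure.toENNRealVectorMeasure_apply_measurable hA] at h
  rw [curvatureMeasure_apply h_int hA, curvatureValue,
    setIntegral_measure_zero _ (reverseRadial_null_of_surfaceArea_null K hA h), mul_zero]

end AbsoluteContinuity

section WeakConvergence

theorem continuous_integral_curvatureMeasure (h_cont : Continuous (densityKernel G ψ))
    {g : Sph n → ℝ} (hg : Continuous g) :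
    Continuous fun K => ∫ᵛ u, g u ∂•(curvatureMeasure G ψ K) := by
  simp_rw [integral_curvatureMeasure (integrable_density h_cont _) hg]
  exact continuous_integral_comp_radialGauss
    (h := fun p => g p.2.2 * (1 / (n : ℝ) * densityKernel G ψ p)) (by fun_prop)

end WeakConvergence

section ConstantSign

theorem density_pos (hG_pos : ∀ t : ℝ, 0 < t → ∀ u : Sph n, 0 < deriv (fun s => G s u) t)
    (hψpos : ∀ t : ℝ, 0 < t → 0 < ψ t) (K : BodyO n) (u : Sph n) : 0 < density G ψ K u :=
  div_pos (mul_pos (radial_pos K u) (hG_pos _ (radial_pos K u) u)) (hψpos _ (supp_pos K _))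

theorem density_neg (K : BodyO n) : density (-G) ψ K = -density G ψ K := by
  ext u
  have deriv_neg_apply (t : ℝ) : deriv (fun s => (-G) s u) t = -deriv (fun s => G s u) t :=
    deriv.fun_neg
  rw [Pi.neg_apply, density, density, deriv_neg_apply, mul_neg, neg_div]

theorem curvatureMeasure_neg {K : BodyO n}
    (h_int : Integrable (density G ψ K) (μHE[n - 1] : Measure (Sph n))) :
    curvatureMeasure (-G) ψ K = -curvatureMeasure G ψ K := by
  refine curvatureMeasure_eq_of_forall_apply fun A hA => ?_
  rw [_root_.neg_apply, curvatureMeasure_apply h_int hA, curvatureValue, curvatureValue,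
    density_neg]
  simp only [Pi.neg_apply, integral_neg, mul_neg]

theorem integrable_comp_radialGauss_mul (K : BodyO n) {g f : Sph n → ℝ} (hg : Continuous g)
    (hf : Integrable f (μHE[n - 1] : Measure (Sph n))) :
    Integrable (fun u => g (radialGauss K u) * f u) (μHE[n - 1] : Measure (Sph n)) := by
  obtain ⟨c, hc⟩ := isCompact_univ.exists_bound_of_continuousOn hg.continuousOn
  exact hf.bdd_mul
    (hg.measurable.comp_aemeasurable (aemeasurable_radialGauss K)).aestronglyMeasurable
    (.of_forall fun u => hc _ (mem_univ _))

theorem integral_max_inner_radialGauss_pos (K : BodyO n) {f : Sph n → ℝ}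
    (hf : Integrable f (μHE[n - 1] : Measure (Sph n))) (hf_pos : ∀ u, 0 < f u) (v : Sph n) :
    0 < ∫ u, max ⟪(radialGauss K u : Euc n), (v : Euc n)⟫ 0 * f u
      ∂(μHE[n - 1] : Measure (Sph n)) := by
  rw [integral_pos_iff_support_of_nonneg_ae
    (.of_forall fun u => mul_nonneg (le_max_right _ _) (hf_pos u).le)
    (integrable_comp_radialGauss_mul K
      (g := fun w => max ⟪(w : Euc n), (v : Euc n)⟫ 0) (by fun_prop) hf)]
  have h_nhds := Measure.measure_pos_of_mem_nhds (μHE[n - 1] : Measure (Sph n))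
    (eventually_inner_pos_of_mem_radialNormals K v)
  refine h_nhds.trans_le (measure_mono_ae ?_)
  filter_upwards [ae_radialNormals_eq_radialGauss K] with u hu h_inner
  have inner_pos := h_inner (radialGauss K u) (hu ▸ mem_singleton _)
  exact (mul_pos (lt_max_of_lt_left inner_pos) (hf_pos u)).ne'

theorem NotInClosedHemisphere.ne_zero (hn : 1 ≤ n) {μ : Measure (Sph n)}
    (hμ : NotInClosedHemisphere μ) : μ ≠ 0 := by
  rintro rfl
  simpa using hμ ⟨EuclideanSpace.single ⟨0, hn⟩ 1, by simp⟩

theorem curvatureMeasure_nonneg {K : BodyO n}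
    (h_int : Integrable (density G ψ K) (μHE[n - 1] : Measure (Sph n)))
    (h_nonneg : ∀ u, 0 ≤ density G ψ K u) : 0 ≤ curvatureMeasure G ψ K := by
  refine VectorMeasure.le_iff.2 fun A hA => ?_
  rw [curvatureMeasure_apply h_int hA]
  exact mul_nonneg (by positivity) (integral_nonneg h_nonneg)

theorem exists_finiteMeasure_eq_curvatureMeasure (hn : 1 ≤ n) {K : BodyO n}
    (h_int : Integrable (density G ψ K) (μHE[n - 1] : Measure (Sph n)))
    (h_pos : ∀ u, 0 < density G ψ K u) :
    ∃ μ : FiniteMeasure (Sph n), (μ : Measure (Sph n)).toSignedMeasure = curvatureMeasure G ψ K ∧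
      μ ≠ 0 ∧ NotInClosedHemisphere (μ : Measure (Sph n)) := by
  obtain ⟨μ, hμ⟩ := exists_finiteMeasure_toSignedMeasure_eq
    (curvatureMeasure_nonneg h_int fun u => (h_pos u).le)
  have h_hemi : NotInClosedHemisphere (μ : Measure (Sph n)) := fun v => by
    rw [← integral_smul_toSignedMeasure, hμ, integral_curvatureMeasure h_int (by fun_prop)]
    exact integral_max_inner_radialGauss_pos K (h_int.const_mul _)
      (fun u => mul_pos (by positivity) (h_pos u)) v
  exact ⟨μ, hμ, fun h => h_hemi.ne_zero hn (congrArg Subtype.val h), h_hemi⟩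

end ConstantSign

end DualOrlicz

theorem mainTheorem9 (n : ℕ) (hn : 1 ≤ n) (G : ℝ → Sph n → ℝ) (ψ : ℝ → ℝ)
    (hG : ContinuousOn (fun p : ℝ × Sph n => G p.1 p.2) (Ioi 0 ×ˢ univ))
    (hGd : ∀ t : ℝ, 0 < t → ∀ u : Sph n, DifferentiableAt ℝ (fun s => G s u) t)
    (hGt : ContinuousOn (fun p : ℝ × Sph n => deriv (fun s => G s p.2) p.1) (Ioi 0 ×ˢ univ))
    (hψ : ContinuousOn ψ (Ioi 0)) (hψpos : ∀ t : ℝ, 0 < t → 0 < ψ t)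
    (K : BodyO n) :
    -- the curvature measure is well defined by its integral formula
    (Integrable (density G ψ K) (μHE[n - 1] : Measure (Sph n)) ∧
      ∀ A : Set (Sph n), MeasurableSet A →
        NullMeasurableSet (reverseRadial K A) (μHE[n - 1] : Measure (Sph n)) ∧
        curvatureMeasure G ψ K A = curvatureValue G ψ K A) ∧
    -- (i) absolute continuity with respect to the surface area measure
    (curvatureMeasure G ψ K ≪ᵥ (surfaceArea K).toENNRealVectorMeasure) ∧
    -- (ii) weak continuity with respect to Hausdorff convergence
    (∀ L : ℕ → BodyO n, Tendsto L atTop (𝓝 K) →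
      WeakConv (fun i => curvatureMeasure G ψ (L i)) (curvatureMeasure G ψ K)) ∧
    -- (iii) constant sign of `G_t`
    ((∀ t : ℝ, 0 < t → ∀ u : Sph n, 0 < deriv (fun s => G s u) t) →
      ∃ μ : FiniteMeasure (Sph n), (μ : Measure (Sph n)).toSignedMeasure = curvatureMeasure G ψ K ∧
        μ ≠ 0 ∧ NotInClosedHemisphere (μ : Measure (Sph n))) ∧
    ((∀ t : ℝ, 0 < t → ∀ u : Sph n, deriv (fun s => G s u) t < 0) →
      ∃ μ : FiniteMeasure (Sph n), (μ : Measure (Sph n)).toSignedMeasure = -curvatureMeasure G ψ K ∧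
        μ ≠ 0 ∧ NotInClosedHemisphere (μ : Measure (Sph n))) := by
  have h_cont := continuous_densityKernel hGt hψ hψpos
  have h_int := integrable_density h_cont K
  refine ⟨⟨h_int, fun A hA => ⟨?_, curvatureMeasure_apply h_int hA⟩⟩,
    curvatureMeasure_absolutelyContinuous h_int, fun L hL g hg => ?_, fun hG_pos => ?_,
    fun hG_neg => ?_⟩
  · exact ((aemeasurable_radialGauss K).nullMeasurableSet_preimage hA).congr
      (reverseRadial_ae_eq K A).symm
  · exact ((continuous_integral_curvatureMeasure h_cont hg).tendsto K).comp hL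
  · exact exists_finiteMeasure_eq_curvatureMeasure hn h_int (density_pos hG_pos hψpos K)
  · rw [← curvatureMeasure_neg h_int]
    refine exists_finiteMeasure_eq_curvatureMeasure hn (density_neg K ▸ h_int.neg)
      (density_pos (fun t ht u => ?_) hψpos K)
    simpa only [Pi.neg_apply, deriv.fun_neg, neg_pos] using hG_neg t ht u
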